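/- Let $\underline{C}$ be a triangulated category with a weight structure $w$ (homological convention): classes $\underline{C}_{w\le 0},\underline{C}_{w\ge 0}$ of objects that are closed under retracts, with $\underline{C}_{w\le 0}\subset \underline{C}_{w\le 0}[1]$, $\underline{C}_{w\ge 0}[1]\subset \underline{C}_{w\ge 0}$, $\underline{C}(X,Y[1])=0$ for $X\in\underline{C}_{w\le 0}$, $Y\in\underline{C}_{w\ge 0}$, and such that every object $M$ fits into a distinguished triangle $L\to M\to R[1]\to L[1]$ with $L\in \underline{C}_{w\le 0}$, $R\in\underline{C}_{w\ge 0}$. Assume that $w$ is bounded, i.e. every object lies in $\underline{C}_{w\le 0}[i]\cap\underline{C}_{w\ge 0}[j]$ for some $i,j\in\mathbb{Z}$, and let $\underline{Hw}$ be its heart, the full subcategory with the class of objects $\underline{C}_{w=0}=\underline{C}_{w\le 0}\cap\underline{C}_{w\ge 0}$. Let $t^{st}:\underline{C}\to K^b(\underline{Hw})$, $M\mapsto (M^i)$, be a strong weight complex functor: an exact functor to the homotopy category of bounded cochain complexes whose restriction to $\underline{Hw}$ is isomorphic to the obvious embedding $\underline{Hw}\to K^b(\underline{Hw})$ (in degree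 $0$). For an additive category $\underline{B}$ let $K_0^{add}(\underline{B})$ be the abelian group generated by the isomorphism classes of objects with the relations $[Y]=[X]+[Z]$ whenever $Y\cong X\oplus Z$; let $K_0^{tr}(\underline{C})$ be the abelian group generated by the isomorphism classes of objects with the relations $[Y]=[X]+[Z]$ for all distinguished triangles $X\to Y\to Z\to X[1]$. Let $F:\underline{Hw}\to\underline{A}$ be an additive functor to an additive category. If $\underline{A}$ is abelian, let $H^F(M)$ be the zeroth homology of the complex $(F(M^i))$, where $(M^i)=t^{st}(M)$, and $H^F_j=H^F\circ[-j]$ for $j\in\mathbb{Z}$. 1. The correspondence $M\mapsto\sum_{i\in\mathbb{Z}}(-1)^i[F(M^i)]$, where $t^{st}(M)=(M^i)$, gives a well-defined homomorphism $F_{K_0}:K_0^{tr}(\underline{C})\to K_0^{add}(\underline{A})$; moreover, the sum does not change if $(M^i)$ is replaced by any bounded complex isomorphic to $t^{st}(M)$ in $K^b(\underline{Hw})$. 2. Assume that $\underline{A}$ is abelian, $N$ is an object of $\underline{C}$, $N'\in\underline{C}_{w=0}$, and there is a $\underline{C}$-morphism $h$, either from $N'$ to $N$ or from $N$ to $N'$,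 such that $F_{K_0}([\mathrm{Cone}(h)])=0$. Then $F_{K_0}([N])=[F(N')]$. If, moreover, $H^F_j(\mathrm{Cone}(h))=0$ for $j=0,1$, then $F_{K_0}([N])=[H^F(N)]$. 3. Assume that $\underline{A}$ is abelian and semi-simple (all short exact sequences in $\underline{A}$ split). Then $F_{K_0}([N])=\sum_{i\in\mathbb{Z}}(-1)^i[H^F_i(N)]$ for every object $N$ of $\underline{C}$. 4. For $F=\mathrm{id}_{\underline{Hw}}$ the homomorphism $\mathrm{id}_{\underline{Hw},K_0}:K_0^{tr}(\underline{C})\to K_0^{add}(\underline{Hw})$ is an isomorphism. -/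

import Mathlib

open CategoryTheory Category Limits Pretriangulated

universe v u v' u'

/-! ### Weight structures -/

section WeightStructures

variable (C : Type u) [Category.{v} C] [Preadditive C] [HasZeroObject C] [HasShift C ℤ]
  [∀ n : ℤ, (shiftFunctor C n).Additive] [Pretriangulated C]

/-- A weight structure on a triangulated category (homological convention):
`le` is the class `C_{w ≤ 0}` and `ge` is the class `C_{w ≥ 0}`. -/
structure WeightStructure where
  /-- the class `C_{w ≤ 0}` -/
  le : ObjectProperty C
  /-- the class `C_{w ≥ 0}` -/
  ge : ObjectProperty C
  le_retract : ∀ {X Y : C}, Retract X Y → le Y → le X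
  ge_retract : ∀ {X Y : C}, Retract X Y → ge Y → ge X
  /-- `C_{w ≤ 0} ⊆ C_{w ≤ 0}[1]` -/
  le_shift : ∀ {X : C}, le X → le (X⟦(-1 : ℤ)⟧)
  /-- `C_{w ≥ 0}[1] ⊆ C_{w ≥ 0}` -/
  ge_shift : ∀ {X : C}, ge X → ge (X⟦(1 : ℤ)⟧)
  /-- `C_{w ≤ 0} ⊥ C_{w ≥ 0}[1]` -/
  orthogonal : ∀ {X Y : C}, le X → ge Y → ∀ f : X ⟶ Y⟦(1 : ℤ)⟧, f = 0
  /-- every `M` has a weight decomposition `L ⟶ M ⟶ R[1] ⟶ L[1]` -/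
  decomposition : ∀ M : C, ∃ (L R : C) (_ : le L) (_ : ge R)
    (a : L ⟶ M) (b : M ⟶ R⟦(1 : ℤ)⟧) (c : R⟦(1 : ℤ)⟧ ⟶ L⟦(1 : ℤ)⟧),
    Triangle.mk a b c ∈ distTriang C

namespace WeightStructure

variable {C} (w : WeightStructure C)

/-- `C_{w ≤ i} = C_{w ≤ 0}[i]` -/
def leAt (i : ℤ) : ObjectProperty C := fun M => w.le (M⟦-i⟧)

/-- `C_{w ≥ i} = C_{w ≥ 0}[i]` -/
def geAt (i : ℤ) : ObjectProperty C := fun M => w.ge (M⟦-i⟧)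

/-- `(C, w)` is bounded: every object lies in some `C_{w ≤ i}` and in some `C_{w ≥ j}`. -/
def IsBounded : Prop := ∀ M : C, (∃ i, w.leAt i M) ∧ (∃ j, w.geAt j M)

/-- the class `C_{w = 0}` -/
def heart : ObjectProperty C := fun M => w.le M ∧ w.ge M

/-- The heart `Hw`: the full subcategory of `C` on the objects of `C_{w = 0}`. -/
abbrev Heart : Type u := w.heart.FullSubcategory

/-! The heart is an additive category. -/

lemma le_of_orthogonal {X : C} (h : ∀ (R : C), w.ge R → ∀ f : X ⟶ R⟦(1 : ℤ)⟧, f = 0) :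
    w.le X := by
  obtain ⟨L, R, hL, hR, a, b, c, hT⟩ := w.decomposition X
  obtain ⟨s, hs⟩ := Triangle.coyoneda_exact₂ _ hT (𝟙 X) ((id_comp b).trans (h R hR b))
  exact w.le_retract ⟨s, a, hs.symm⟩ hL

lemma ge_of_orthogonal {X : C} (h : ∀ (L : C), w.le L → ∀ f : L ⟶ X⟦(1 : ℤ)⟧, f = 0) :
    w.ge X := by
  obtain ⟨L, R, hL, hR, a, b, c, hT⟩ := w.decomposition (X⟦(1 : ℤ)⟧)
  obtain ⟨s, hs⟩ := Triangle.yoneda_exact₂ _ hT (𝟙 (X⟦(1 : ℤ)⟧)) ((comp_id a).trans (h L hL a))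
  have e : Retract (X⟦(1 : ℤ)⟧) (R⟦(1 : ℤ)⟧) := ⟨b, s, hs.symm⟩
  refine w.ge_retract ⟨(shiftFunctor C (1 : ℤ)).preimage e.i,
    (shiftFunctor C (1 : ℤ)).preimage e.r, ?_⟩ hR
  apply (shiftFunctor C (1 : ℤ)).map_injective
  simp

lemma le_biprod {X Y : C} (hX : w.le X) (hY : w.le Y) : w.le (X ⊞ Y) :=
  w.le_of_orthogonal fun R hR f => by
    apply biprod.hom_ext'
    · rw [w.orthogonal hX hR (biprod.inl ≫ f), comp_zero]
    · rw [w.orthogonal hY hR (biprod.inr ≫ f), comp_zero]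

lemma ge_biprod {X Y : C} (hX : w.ge X) (hY : w.ge Y) : w.ge (X ⊞ Y) :=
  w.ge_of_orthogonal fun L hL f => by
    have e : 𝟙 ((X ⊞ Y)⟦(1 : ℤ)⟧) =
        (biprod.fst ≫ biprod.inl : X ⊞ Y ⟶ X ⊞ Y)⟦(1 : ℤ)⟧' +
        (biprod.snd ≫ biprod.inr : X ⊞ Y ⟶ X ⊞ Y)⟦(1 : ℤ)⟧' := by
      rw [← Functor.map_add, biprod.total, CategoryTheory.Functor.map_id]
    rw [← comp_id f, e, Preadditive.comp_add, Functor.map_comp, Functor.map_comp,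
      ← assoc, ← assoc, w.orthogonal hL hX (f ≫ _), w.orthogonal hL hY (f ≫ _)]
    simp

instance : w.heart.ContainsZero where
  exists_zero := by
    obtain ⟨Z, hZ⟩ := HasZeroObject.zero (C := C)
    exact ⟨Z, hZ, w.le_of_orthogonal fun _ _ _ => hZ.eq_of_src _ _,
      w.ge_of_orthogonal fun _ _ _ => ((shiftFunctor C (1 : ℤ)).map_isZero hZ).eq_of_tgt _ _⟩

instance : HasBinaryBiproducts w.Heart where
  has_binary_biproduct X Y :=
    hasBinaryBiproduct_of_total
      { pt := ⟨X.obj ⊞ Y.obj, w.le_biprod X.property.1 Y.property.1,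
          w.ge_biprod X.property.2 Y.property.2⟩
        fst := ObjectProperty.homMk biprod.fst
        snd := ObjectProperty.homMk biprod.snd
        inl := ObjectProperty.homMk biprod.inl
        inr := ObjectProperty.homMk biprod.inr
        inl_fst := by ext; exact biprod.inl_fst
        inl_snd := by ext; exact biprod.inl_snd
        inr_fst := by ext; exact biprod.inr_fst
        inr_snd := by ext; exact biprod.inr_snd }
      (ObjectProperty.hom_ext _ (biprod.total (X := X.obj) (Y := Y.obj)))

end WeightStructure

end WeightStructures

/-! ### The homotopy category of bounded complexes -/

section BoundedComplexes

variable (B : Type u) [Category.{v} B] [Preadditive B]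

/-- The objects of `K(B)` that are bounded cochain complexes. -/
def boundedComplexes : ObjectProperty (HomotopyCategory B (ComplexShape.up ℤ)) :=
  fun K => ∃ a b : ℤ, ∀ i : ℤ, (i < a ∨ b < i) → IsZero (K.as.X i)

/-- `K^b(B)`: the homotopy category of bounded cochain complexes over `B`, as a full
subcategory of `K(B)`. -/
abbrev Kb : Type (max u v) := (boundedComplexes B).FullSubcategory

instance boundedComplexes_isStableUnderShift : (boundedComplexes B).IsStableUnderShift ℤ where
  isStableUnderShiftBy n :=
    { le_shift K hK := by
        obtain ⟨K : CochainComplex _ _, rfl⟩ := K.quotient_obj_surjective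
        obtain ⟨a, b, h⟩ := hK
        rw [ObjectProperty.prop_shift_iff, HomotopyCategory.shift_quotient_obj]
        exact ⟨a - n, b - n, fun i hi => h (i + n) (by lia)⟩ }

variable [HasZeroObject B]

instance boundedComplexes_containsZero : (boundedComplexes B).ContainsZero where
  exists_zero := by
    obtain ⟨Z, hZ⟩ := HasZeroObject.zero (C := CochainComplex B ℤ)
    exact ⟨(HomotopyCategory.quotient _ _).obj Z, Functor.map_isZero _ hZ, 0, 0,
      fun i _ => (HomologicalComplex.eval B (ComplexShape.up ℤ) i).map_isZero hZ⟩

/-- The obvious embedding `B ⥤ K^b(B)`, sending `X` to the complex `X` in degree `0`. -/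
noncomputable def KbSingle : B ⥤ Kb B :=
  (boundedComplexes B).lift
    (HomologicalComplex.single B (ComplexShape.up ℤ) 0 ⋙ HomotopyCategory.quotient _ _)
    (fun X => ⟨0, 0, fun i hi =>
      HomologicalComplex.isZero_single_obj_X (ComplexShape.up ℤ) 0 X i (by lia)⟩)

variable [HasBinaryBiproducts B]

instance boundedComplexes_isTriangulatedClosed₃ :
    (boundedComplexes B).IsTriangulatedClosed₃ where
  ext₃' T hT h₁ h₂ := by
    obtain ⟨a₁, b₁, h₁⟩ := h₁
    obtain ⟨a₂, b₂, h₂⟩ := h₂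
    obtain ⟨f, hf⟩ := (HomotopyCategory.quotient B (ComplexShape.up ℤ)).map_surjective
      (X := T.obj₁.as) (Y := T.obj₂.as) T.mor₁
    refine ⟨_, ?_, ⟨Triangle.π₃.mapIso (isoTriangleOfIso₁₂ T _ hT
      (HomotopyCategory.mappingCone_triangleh_distinguished f) (Iso.refl _) (Iso.refl _) ?_)⟩⟩
    · refine ⟨min (a₁ - 1) a₂, max (b₁ - 1) b₂, fun i hi => ?_⟩
      exact (CochainComplex.mappingCone.isZero_X_iff f i).2
        ⟨h₁ _ (by lia), h₂ _ (by lia)⟩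
    · exact (comp_id _).trans (hf.symm.trans (id_comp _).symm)

instance boundedComplexes_isTriangulated : (boundedComplexes B).IsTriangulated where
  toIsTriangulatedClosed₂ := .of_isTriangulatedClosed₃

end BoundedComplexes

/-! ### Grothendieck groups -/

section GrothendieckGroups

/-- The class of an object among the generators: the isomorphism classes of objects. -/
def isoClassGen {B : Type u} [Category.{v} B] (X : B) :
    FreeAbelianGroup (Quotient (isIsomorphicSetoid B)) :=
  FreeAbelianGroup.of (Quotient.mk (isIsomorphicSetoid B) X)

variable (B : Type u) [Category.{v} B] [Preadditive B] [HasBinaryBiproducts B]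

/-- The relations `[Y] = [X] + [Z]` whenever `Y ≅ X ⊕ Z`. -/
def K0AddRel : AddSubgroup (FreeAbelianGroup (Quotient (isIsomorphicSetoid B))) :=
  AddSubgroup.closure
    { r | ∃ X Y Z : B, Nonempty (Y ≅ X ⊞ Z) ∧
        r = isoClassGen Y - (isoClassGen X + isoClassGen Z) }

/-- The split Grothendieck group `K_0^add(B)` of an additive category. -/
abbrev K0Add : Type u := FreeAbelianGroup (Quotient (isIsomorphicSetoid B)) ⧸ K0AddRel B

variable {B} in
/-- The class `[X]` in `K_0^add(B)`. -/
def K0Add.of (X : B) : K0Add B := QuotientAddGroup.mk (isoClassGen X)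

variable (C : Type u) [Category.{v} C] [Preadditive C] [HasZeroObject C] [HasShift C ℤ]
  [∀ n : ℤ, (shiftFunctor C n).Additive] [Pretriangulated C]

/-- The relations `[T₂] = [T₁] + [T₃]` for all distinguished triangles
`T₁ ⟶ T₂ ⟶ T₃ ⟶ T₁[1]`. -/
def K0TrRel : AddSubgroup (FreeAbelianGroup (Quotient (isIsomorphicSetoid C))) :=
  AddSubgroup.closure
    { r | ∃ T ∈ distTriang C,
        r = isoClassGen T.obj₂ - (isoClassGen T.obj₁ + isoClassGen T.obj₃) }

/-- The Grothendieck group `K_0^tr(C)` of a triangulated category. -/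
abbrev K0Tr : Type u := FreeAbelianGroup (Quotient (isIsomorphicSetoid C)) ⧸ K0TrRel C

variable {C} in
/-- The class `[M]` in `K_0^tr(C)`. -/
def K0Tr.of (M : C) : K0Tr C := QuotientAddGroup.mk (isoClassGen M)

/-- `Z` is a cone of `h`. -/
def IsConeOf {C : Type u} [Category.{v} C] [Preadditive C] [HasZeroObject C] [HasShift C ℤ]
    [∀ n : ℤ, (shiftFunctor C n).Additive] [Pretriangulated C]
    {X Y : C} (h : X ⟶ Y) (Z : C) : Prop :=
  ∃ (g : Y ⟶ Z) (d : Z ⟶ X⟦(1 : ℤ)⟧), Triangle.mk h g d ∈ distTriang C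

end GrothendieckGroups

/-- An abelian category is semi-simple if all short exact sequences in it split. -/
def IsSemisimpleAbelian (A : Type u) [Category.{v} A] [Abelian A] : Prop :=
  ∀ S : ShortComplex A, S.ShortExact → Nonempty S.Splitting

/-! ### Strong weight complexes and pure homological functors -/

section WeightComplexes

variable {C : Type u} [Category.{v} C] [Preadditive C] [HasZeroObject C] [HasShift C ℤ]
  [∀ n : ℤ, (shiftFunctor C n).Additive] [Pretriangulated C]

/-- A strong weight complex functor for `w`: an exact functor `C ⥤ K^b(Hw)` whose restriction
to the heart is isomorphic to the obvious embedding `Hw ⥤ K^b(Hw)`. -/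
structure StrongWeightComplex (w : WeightStructure C) where
  /-- the functor `t^st` -/
  functor : C ⥤ Kb w.Heart
  /-- the compatibility with shifts -/
  commShift : functor.CommShift ℤ
  isTriangulated : functor.IsTriangulated
  /-- the restriction to the heart -/
  heartIso : w.heart.ι ⋙ functor ≅ KbSingle w.Heart

variable {w : WeightStructure C}

/-- `χ_F(K) = Σ_i (-1)^i [F(K^i)]` for a bounded complex `K = (K^i)` over the heart; only
finitely many summands are non-zero. -/
noncomputable def eulerSum {A : Type u'} [Category.{v'} A] [Preadditive A]
    [HasBinaryBiproducts A] (F : w.Heart ⥤ A) (K : Kb w.Heart) : K0Add A :=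
  ∑ᶠ i : ℤ, i.negOnePow • K0Add.of (F.obj (K.obj.as.X i))

namespace StrongWeightComplex

attribute [instance] commShift isTriangulated

variable (t : StrongWeightComplex w)

/-- `φ` is the homomorphism `F_{K_0}`: it sends `[M]` to `Σ_i (-1)^i [F(M^i)]`, where
`t^st(M) = (M^i)`. -/
def IsFK0 {A : Type u'} [Category.{v'} A] [Preadditive A] [HasBinaryBiproducts A]
    (F : w.Heart ⥤ A) (φ : K0Tr C →+ K0Add A) : Prop :=
  ∀ M : C, φ (K0Tr.of M) = eulerSum F (t.functor.obj M)

/-- The functor `H^F`: it sends `M` to the zeroth homology of the complex `(F(M^i))`, where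
`t^st(M) = (M^i)`. -/
noncomputable def pureFunctor {A : Type u'} [Category.{v'} A] [Abelian A]
    (F : w.Heart ⥤ A) [F.Additive] : C ⥤ A :=
  t.functor ⋙ (boundedComplexes w.Heart).ι ⋙ F.mapHomotopyCategory (ComplexShape.up ℤ) ⋙
    HomotopyCategory.homologyFunctor A (ComplexShape.up ℤ) 0

/-- `H_j^F = H^F ∘ [-j]` -/
noncomputable def pureFunctorAt {A : Type u'} [Category.{v'} A] [Abelian A]
    (F : w.Heart ⥤ A) [F.Additive] (j : ℤ) : C ⥤ A :=
  shiftFunctor C (-j) ⋙ t.pureFunctor F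

end StrongWeightComplex

end WeightComplexes

/-! The core is that the Euler characteristic `Σ (-1)^i [K^i]` of a bounded complex, taken in the
split Grothendieck group, is a homotopy invariant. A mapping cone has terms `K^{i+1} ⊕ L^i`, so its
characteristic is that of `L` minus that of `K`; as an isomorphism in the homotopy category has a
contractible cone, it suffices to treat contractible complexes. No splitting of idempotents is
needed there: a contraction can be replaced by one, `s`, with `s² = 0`, and then `(d + s)² = 1`, so
`d + s` exchanges the sum of the even terms and the sum of the odd terms (`Homotopy.biproductIso`).
Distinguished triangles are isomorphic to cone triangles, so the characteristic is additive on them;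
combined with the exact functor `t` and with `K0Add.map F`, this gives `StrongWeightComplex.mapK0`.

On the heart this homomorphism is `[X] ↦ [F(X)]`, which with additivity handles a morphism `h` whose
cone has class zero. Since `H^F` is homological, its vanishing on the cone in degrees 0 and 1 makes
`H^F(h)` invertible (`isIso_pureFunctor_map`). In the semi-simple case, terms and homology are
compared through cycles.

For the identity functor, the map `heartK0` induced by the inclusion of the heart is a section. It
is also surjective, because weight decompositions peel objects of the heart off a bounded object one
at a time (`of_mem_range_heartK0_of_ge`). -/

/-! ### Alternating sums -/

section AlternatingSums

variable {M : Type*} [AddCommGroup M]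

/-- The alternating sum `Σ_i (-1)^i x_i`. -/
noncomputable def alternatingSum (x : ℤ → M) : M := ∑ᶠ i : ℤ, i.negOnePow • x i

/-- A family indexed by `ℤ` that vanishes outside of an interval. -/
def IsBoundedFamily (x : ℤ → M) : Prop := ∃ a b : ℤ, ∀ i : ℤ, (i < a ∨ b < i) → x i = 0

/-- Guards against the default value 0 of `finsum` on infinite supports. -/
lemma IsBoundedFamily.finite_support {x : ℤ → M} (hx : IsBoundedFamily x) :
    (Function.support fun i : ℤ => i.negOnePow • x i).Finite := by
  obtain ⟨a, b, h⟩ := hx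
  refine (Set.finite_Icc a b).subset fun i hi => ?_
  by_contra hi'
  rw [Set.mem_Icc] at hi'
  exact hi (by simp only [h i (by lia), smul_zero])

lemma IsBoundedFamily.shift {x : ℤ → M} (hx : IsBoundedFamily x) (n : ℤ) :
    IsBoundedFamily (fun i => x (i + n)) := by
  obtain ⟨a, b, h⟩ := hx
  exact ⟨a - n, b - n, fun i hi => h _ (by lia)⟩

lemma alternatingSum_add {x y : ℤ → M} (hx : IsBoundedFamily x) (hy : IsBoundedFamily y) :
    alternatingSum (fun i => x i + y i) = alternatingSum x + alternatingSum y := by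
  simp only [alternatingSum, smul_add]
  exact finsum_add_distrib hx.finite_support hy.finite_support

/-- Reindexing a `finsum` along a bijection and negating it are unconditional, so no boundedness is
required. -/
lemma alternatingSum_shift (x : ℤ → M) :
    alternatingSum (fun i => x (i + 1)) = -alternatingSum x := by
  unfold alternatingSum
  rw [← finsum_comp_equiv (Equiv.addRight (1 : ℤ)) (f := fun i : ℤ => i.negOnePow • x i),
    ← finsum_neg_distrib]
  refine finsum_congr fun i => ?_
  simp [Int.negOnePow_succ, Units.smul_def]

lemma alternatingSum_neg (x : ℤ → M) :
    alternatingSum (fun i => x (-i)) = alternatingSum x := by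
  unfold alternatingSum
  rw [← finsum_comp_equiv (Equiv.neg ℤ) (f := fun i : ℤ => i.negOnePow • x i)]
  refine finsum_congr fun i => ?_
  simp [Int.negOnePow_neg]

lemma map_alternatingSum {N : Type*} [AddCommGroup N] (f : M →+ N) {x : ℤ → M}
    (hx : IsBoundedFamily x) : f (alternatingSum x) = alternatingSum (fun i => f (x i)) := by
  unfold alternatingSum
  rw [f.map_finsum hx.finite_support]
  refine finsum_congr fun i => ?_
  simp [Units.smul_def]

/-- Removes the signs, so that vanishing becomes an equality between the even and the odd part. -/
lemma alternatingSum_eq_sub {x : ℤ → M} {a b : ℤ} (h : ∀ i, (i < a ∨ b < i) → x i = 0) :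
    alternatingSum x = ∑ i ∈ (Finset.Icc a b).filter Even, x i -
      ∑ i ∈ (Finset.Icc a b).filter (fun i => ¬ Even i), x i := by
  unfold alternatingSum
  rw [finsum_eq_sum_of_support_subset (s := Finset.Icc a b),
    ← Finset.sum_filter_add_sum_filter_not _ Even, sub_eq_add_neg, ← Finset.sum_neg_distrib]
  · congr 1
    · refine Finset.sum_congr rfl fun i hi => ?_
      rw [Int.negOnePow_even _ (Finset.mem_filter.1 hi).2, one_smul]
    · refine Finset.sum_congr rfl fun i hi => ?_
      rw [Int.negOnePow_odd _ (Int.not_even_iff_odd.1 (Finset.mem_filter.1 hi).2)]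
      simp [Units.smul_def]
  · intro i hi
    by_contra hi'
    rw [Finset.coe_Icc, Set.mem_Icc] at hi'
    exact hi (by simp only [h i (by lia), smul_zero])

end AlternatingSums

/-! ### The split Grothendieck group -/

namespace K0Add

section

variable {B : Type u} [Category.{v} B] [Preadditive B] [HasBinaryBiproducts B]

lemma of_eq_add {X Y Z : B} (e : Y ≅ X ⊞ Z) : K0Add.of Y = K0Add.of X + K0Add.of Z := by
  rw [← sub_eq_zero]
  exact (QuotientAddGroup.eq_zero_iff _).2 (AddSubgroup.subset_closure ⟨X, Y, Z, ⟨e⟩, rfl⟩)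

lemma of_iso {X Y : B} (e : X ≅ Y) : K0Add.of X = K0Add.of Y := by
  unfold K0Add.of isoClassGen
  rw [Quotient.sound (s := isIsomorphicSetoid B) (show Nonempty (X ≅ Y) from ⟨e⟩)]

lemma of_isZero {X : B} (h : IsZero X) : K0Add.of X = 0 := by
  have e : X ≅ X ⊞ X := h.iso ((biprod_isZero_iff X X).2 ⟨h, h⟩)
  simpa using of_eq_add e

lemma of_isBoundedFamily {X : ℤ → B} {a b : ℤ} (h : ∀ i, (i < a ∨ b < i) → IsZero (X i)) :
    IsBoundedFamily (fun i => K0Add.of (X i)) :=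
  ⟨a, b, fun i hi => of_isZero (h i hi)⟩

/-- The homomorphism out of `K_0^add(B)` given by an additive invariant. -/
def lift {M : Type*} [AddCommGroup M] (f : B → M)
    (hf : ∀ X Y Z : B, Nonempty (Y ≅ X ⊞ Z) → f Y = f X + f Z)
    (hf' : ∀ X Y : B, Nonempty (X ≅ Y) → f X = f Y) : K0Add B →+ M :=
  QuotientAddGroup.lift _ (FreeAbelianGroup.lift (Quotient.lift f hf')) (by
    rw [K0AddRel, AddSubgroup.closure_le]
    rintro _ ⟨X, Y, Z, e, rfl⟩
    simp only [isoClassGen, SetLike.mem_coe, AddMonoidHom.mem_ker, map_sub, map_add,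
      FreeAbelianGroup.lift_apply_of]
    exact sub_eq_zero.2 (hf X Y Z e))

@[simp]
lemma lift_of {M : Type*} [AddCommGroup M] (f : B → M)
    (hf : ∀ X Y Z : B, Nonempty (Y ≅ X ⊞ Z) → f Y = f X + f Z)
    (hf' : ∀ X Y : B, Nonempty (X ≅ Y) → f X = f Y) (X : B) :
    lift f hf hf' (K0Add.of X) = f X :=
  FreeAbelianGroup.lift_apply_of _ _

lemma hom_ext {M : Type*} [AddCommGroup M] {f g : K0Add B →+ M}
    (h : ∀ X : B, f (K0Add.of X) = g (K0Add.of X)) : f = g := by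
  apply QuotientAddGroup.addMonoidHom_ext
  apply FreeAbelianGroup.lift_ext
  rintro ⟨X⟩
  exact h X

end

section Map

variable {B : Type u} [Category.{v} B] [Preadditive B] [HasBinaryBiproducts B]
  {A : Type u'} [Category.{v'} A] [Preadditive A] [HasBinaryBiproducts A]

/-- The homomorphism induced by an additive functor on split Grothendieck groups. -/
noncomputable def map (F : B ⥤ A) [F.Additive] : K0Add B →+ K0Add A :=
  lift (fun X => K0Add.of (F.obj X))
    (fun X Y Z ⟨e⟩ => by
      have := preservesBinaryBiproducts_of_preservesBiproducts F
      exact of_eq_add (F.mapIso e ≪≫ F.mapBiprod X Z))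
    (fun _ _ ⟨e⟩ => of_iso (F.mapIso e))

@[simp]
lemma map_of (F : B ⥤ A) [F.Additive] (X : B) :
    map F (K0Add.of X) = K0Add.of (F.obj X) :=
  lift_of _ _ _ _

end Map

end K0Add

section FiniteBiproducts

variable {B : Type u} [Category.{v} B] [Preadditive B] [HasBinaryBiproducts B]
  [HasFiniteBiproducts B]

/-- Splitting off the summand `none`. -/
noncomputable def biproductOptionIso {J : Type} [Fintype J] (X : Option J → B) :
    ⨁ X ≅ X none ⊞ ⨁ (fun j => X (some j)) where
  hom := biprod.lift (biproduct.π X none) (biproduct.lift fun j => biproduct.π X (some j))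
  inv := biprod.desc (biproduct.ι X none) (biproduct.desc fun j => biproduct.ι X (some j))
  hom_inv_id := by
    rw [biprod.lift_desc, biproduct.lift_desc, ← biproduct.total, Fintype.sum_option]
  inv_hom_id := by
    classical
    apply biprod.hom_ext' <;> apply biprod.hom_ext <;>
      try apply biproduct.hom_ext' <;> intro j
    all_goals try (apply biproduct.hom_ext; intro k)
    all_goals simp [biproduct.ι_π]

lemma K0Add.of_biproduct {J : Type} [Fintype J] (X : J → B) :
    K0Add.of (⨁ X) = ∑ j, K0Add.of (X j) := by
  revert X
  refine Fintype.induction_empty_option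
    (P := fun J _ => ∀ X : J → B, K0Add.of (⨁ X) = ∑ j, K0Add.of (X j)) ?_ ?_ ?_ J
  · intro α β _ e h X
    let _ := Fintype.ofEquiv β e.symm
    rw [← e.sum_comp, ← h]
    exact (K0Add.of_iso (biproduct.whiskerEquiv e fun j => Iso.refl _)).symm
  · intro X
    rw [Finset.univ_eq_empty, Finset.sum_empty]
    exact K0Add.of_isZero ((IsZero.iff_id_eq_zero _).2 (by ext j; exact j.elim))
  · intro α _ h X
    rw [Fintype.sum_option, ← h, K0Add.of_eq_add (biproductOptionIso X)]

end FiniteBiproducts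

/-! ### Euler characteristics of bounded complexes -/

section Contractions

variable {B : Type u} [Category.{v} B] [Preadditive B] {K : CochainComplex B ℤ}

lemma Homotopy.contraction_comm (h : Homotopy (𝟙 K) 0) {i j k : ℤ} (hij : i + 1 = j)
    (hjk : j + 1 = k) : K.d j k ≫ h.hom k j + h.hom j i ≫ K.d i j = 𝟙 (K.X j) := by
  have := h.comm j
  rw [dNext_eq _ (show (ComplexShape.up ℤ).Rel j k from hjk),
    prevD_eq _ (show (ComplexShape.up ℤ).Rel i j from hij)] at this
  simpa using this.symm

/-- The contraction `s d s` obtained from a contraction `s`: its square is zero. -/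
def Homotopy.normalizedContraction (h : Homotopy (𝟙 K) 0) (i j : ℤ) : K.X i ⟶ K.X j :=
  h.hom i j ≫ K.d j i ≫ h.hom i j

variable (h : Homotopy (𝟙 K) 0)

lemma Homotopy.normalizedContraction_eq_zero (i j : ℤ) (hij : j + 1 ≠ i) :
    h.normalizedContraction i j = 0 := by
  rw [normalizedContraction, h.zero i j hij, zero_comp]

lemma Homotopy.d_contraction_d {i j : ℤ} (hij : i + 1 = j) :
    K.d i j ≫ h.hom j i ≫ K.d i j = K.d i j := by
  have := congrArg (K.d i j ≫ ·) (h.contraction_comm hij rfl)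
  simpa using this

lemma Homotopy.normalizedContraction_comm {i j k : ℤ} (hij : i + 1 = j) (hjk : j + 1 = k) :
    K.d j k ≫ h.normalizedContraction k j + h.normalizedContraction j i ≫ K.d i j =
      𝟙 (K.X j) := by
  have e₁ := h.d_contraction_d hij
  have e₂ := h.d_contraction_d hjk
  simp only [normalizedContraction, assoc]
  rw [e₁, ← h.contraction_comm hij hjk, reassoc_of% e₂]

/-- With `ds + sd = 1` and `dsd = d`, the middle of `(sds)(sds)` collapses: it equals `sds(1 - ds)s
= s(ds - dsds)s = 0`. -/
lemma Homotopy.normalizedContraction_comp (i j k : ℤ) :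
    h.normalizedContraction i j ≫ h.normalizedContraction j k = 0 := by
  by_cases hij : j + 1 = i
  · by_cases hjk : k + 1 = j
    · have e := h.contraction_comm hjk hij
      have e' : h.hom j k ≫ K.d k j = 𝟙 _ - K.d j i ≫ h.hom i j := by rw [← e]; abel
      have e₁ := h.d_contraction_d hij
      simp only [normalizedContraction, assoc]
      rw [reassoc_of% e', Preadditive.sub_comp, id_comp, Preadditive.comp_sub,
        Preadditive.comp_sub, assoc, reassoc_of% e₁, sub_self, comp_zero]
    · rw [h.normalizedContraction_eq_zero j k hjk, comp_zero]
  · rw [h.normalizedContraction_eq_zero i j hij, zero_comp]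

/-- This is `(d + s)² = 1` entry by entry: `d² = s² = 0` leaves only the mixed terms, which preserve
the degree and sum to the identity. Only the intermediate degrees `i ± 1` matter, and the hypothesis
makes those missing from the index set harmless. -/
lemma Homotopy.sum_contraction (s : Finset ℤ) (i k : ℤ)
    (hs : ∀ j ∉ s, j = i + 1 ∨ j + 1 = i → IsZero (K.X j)) :
    ∑ j ∈ s, (K.d i j + h.normalizedContraction i j) ≫
        (K.d j k + h.normalizedContraction j k) =
      if e : i = k then eqToHom (by rw [e]) else 0 := by
  simp only [Preadditive.add_comp, Preadditive.comp_add, HomologicalComplex.d_comp_d,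
    h.normalizedContraction_comp, add_zero, zero_add]
  split_ifs with e
  · subst e
    have h₁ (j : ℤ) (hj : j ∉ ({i - 1, i + 1} : Finset ℤ)) :
        h.normalizedContraction i j ≫ K.d j i + K.d i j ≫ h.normalizedContraction j i = 0 := by
      simp only [Finset.mem_insert, Finset.mem_singleton, not_or] at hj
      rw [h.normalizedContraction_eq_zero i j (by lia),
        h.normalizedContraction_eq_zero j i (by lia), zero_comp, comp_zero, add_zero]
    have h₂ (j : ℤ) (hj : j ∉ s) :
        h.normalizedContraction i j ≫ K.d j i + K.d i j ≫ h.normalizedContraction j i = 0 := by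
      by_cases hj' : j ∈ ({i - 1, i + 1} : Finset ℤ)
      · have hz : IsZero (K.X j) := hs j hj (by
          simp only [Finset.mem_insert, Finset.mem_singleton] at hj'; lia)
        rw [hz.eq_of_src (K.d j i) 0, hz.eq_of_tgt (K.d i j) 0, zero_comp, comp_zero, add_zero]
      · exact h₁ j hj'
    rw [Finset.sum_subset (Finset.subset_union_left (s₂ := {i - 1, i + 1}))
        (fun j _ hj => h₂ j hj),
      ← Finset.sum_subset (Finset.subset_union_right (s₁ := s)) (fun j _ hj => h₁ j hj),
      Finset.sum_pair (by lia), h.normalizedContraction_eq_zero (i - 1) i (by lia),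
      h.normalizedContraction_eq_zero i (i + 1) (by lia), comp_zero, add_zero, zero_comp,
      zero_add, add_comm, eqToHom_refl]
    exact h.normalizedContraction_comm (by lia) rfl
  · refine Finset.sum_eq_zero fun j _ => ?_
    by_cases hij : i + 1 = j
    · rw [h.normalizedContraction_eq_zero i j (by lia),
        h.normalizedContraction_eq_zero j k (by lia), zero_comp, comp_zero, add_zero]
    · rw [K.shape i j hij, zero_comp, add_zero]
      by_cases hij' : j + 1 = i
      · rw [K.shape j k (by simp; lia), comp_zero]
      · rw [h.normalizedContraction_eq_zero i j hij', zero_comp]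

/-- A contraction of a complex identifies the sum of the terms with indices in `s` with the sum
of those in `s'`, if each of these sets contains the neighbours of the other one up to zero
terms. -/
noncomputable def Homotopy.biproductIso [HasFiniteBiproducts B] (s s' : Finset ℤ)
    (hs : ∀ i ∈ s', ∀ j ∉ s, j = i + 1 ∨ j + 1 = i → IsZero (K.X j))
    (hs' : ∀ i ∈ s, ∀ j ∉ s', j = i + 1 ∨ j + 1 = i → IsZero (K.X j)) :
    ⨁ (fun i : s => K.X i) ≅ ⨁ (fun i : s' => K.X i) where
  hom := biproduct.matrix fun i j => K.d i j + h.normalizedContraction i j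
  inv := biproduct.matrix fun i j => K.d i j + h.normalizedContraction i j
  hom_inv_id := by
    classical
    refine biproduct.hom_ext' _ _ fun i => biproduct.hom_ext _ _ fun k => ?_
    simp only [assoc, id_comp]
    -- The `(i, k)` entry of the product of the two matrices is a sum over the intermediate index in
    -- `s'`.
    rw [biproduct.ι_matrix_assoc, biproduct.matrix_π, biproduct.lift_desc,
      Finset.sum_coe_sort s' (fun j => (K.d i j + h.normalizedContraction i j) ≫
        (K.d j k + h.normalizedContraction j k)), h.sum_contraction _ _ _ (hs' i i.2),
      biproduct.ι_π]
    simp only [Subtype.ext_iff]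
  inv_hom_id := by
    classical
    refine biproduct.hom_ext' _ _ fun i => biproduct.hom_ext _ _ fun k => ?_
    simp only [assoc, id_comp]
    rw [biproduct.ι_matrix_assoc, biproduct.matrix_π, biproduct.lift_desc,
      Finset.sum_coe_sort s (fun j => (K.d i j + h.normalizedContraction i j) ≫
        (K.d j k + h.normalizedContraction j k)), h.sum_contraction _ _ _ (hs i i.2),
      biproduct.ι_π]
    simp only [Subtype.ext_iff]

end Contractions

lemma hasFiniteBiproducts_of_hasBinaryBiproducts (B : Type u) [Category.{v} B] [Preadditive B]
    [HasZeroObject B] [HasBinaryBiproducts B] : HasFiniteBiproducts B :=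
  have : HasFiniteProducts B := hasFiniteProducts_of_has_binary_and_terminal
  HasFiniteBiproducts.of_hasFiniteProducts

namespace CochainComplex

variable {B : Type u} [Category.{v} B] [Preadditive B]

/-- A cochain complex that vanishes outside of an interval. -/
def IsBounded (K : CochainComplex B ℤ) : Prop :=
  ∃ a b : ℤ, ∀ i : ℤ, (i < a ∨ b < i) → IsZero (K.X i)

variable [HasBinaryBiproducts B]

/-- The Euler characteristic `Σ_i (-1)^i [K^i]` of a bounded complex. -/
noncomputable def eulerCharacteristic (K : CochainComplex B ℤ) : K0Add B :=
  alternatingSum fun i => K0Add.of (K.X i)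

lemma IsBounded.isBoundedFamily {K : CochainComplex B ℤ} (hK : K.IsBounded) :
    IsBoundedFamily fun i => K0Add.of (K.X i) := by
  obtain ⟨a, b, h⟩ := hK
  exact K0Add.of_isBoundedFamily h

lemma IsBounded.mappingCone {K L : CochainComplex B ℤ} (hK : K.IsBounded) (hL : L.IsBounded)
    (f : K ⟶ L) : (CochainComplex.mappingCone f).IsBounded := by
  obtain ⟨a₁, b₁, h₁⟩ := hK
  obtain ⟨a₂, b₂, h₂⟩ := hL
  exact ⟨min (a₁ - 1) a₂, max (b₁ - 1) b₂, fun i hi =>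
    (CochainComplex.mappingCone.isZero_X_iff f i).2 ⟨h₁ _ (by lia), h₂ _ (by lia)⟩⟩

lemma eulerCharacteristic_mappingCone {K L : CochainComplex B ℤ} (hK : K.IsBounded)
    (hL : L.IsBounded) (f : K ⟶ L) : (CochainComplex.mappingCone f).eulerCharacteristic =
      L.eulerCharacteristic - K.eulerCharacteristic := by
  have h (i : ℤ) : K0Add.of ((CochainComplex.mappingCone f).X i) =
      K0Add.of (K.X (i + 1)) + K0Add.of (L.X i) :=
    K0Add.of_eq_add (HomologicalComplex.homotopyCofiber.XIsoBiprod f i (i + 1) rfl)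
  simp only [eulerCharacteristic, h]
  rw [alternatingSum_add (hK.isBoundedFamily.shift 1) hL.isBoundedFamily,
    alternatingSum_shift (fun i => K0Add.of (K.X i)), sub_eq_neg_add]

variable [HasZeroObject B]

lemma eulerCharacteristic_eq_zero {K : CochainComplex B ℤ} (hK : K.IsBounded)
    (h : Homotopy (𝟙 K) 0) : K.eulerCharacteristic = 0 := by
  obtain ⟨a, b, hab⟩ := hK
  have := hasFiniteBiproducts_of_hasBinaryBiproducts B
  -- Neighbours have opposite parity, so a neighbour missing from the other half lies outside `[a,
  -- b]`, where the complex vanishes.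
  have e := K0Add.of_iso (h.biproductIso ((Finset.Icc a b).filter Even)
    ((Finset.Icc a b).filter (fun i => ¬ Even i))
    (fun i hi j hj hij => hab j (by
      simp only [Finset.mem_filter, Finset.mem_Icc] at hi hj; grind))
    (fun i hi j hj hij => hab j (by
      simp only [Finset.mem_filter, Finset.mem_Icc] at hi hj; grind)))
  rw [K0Add.of_biproduct, K0Add.of_biproduct,
    Finset.sum_coe_sort _ (fun i => K0Add.of (K.X i)),
    Finset.sum_coe_sort _ (fun i => K0Add.of (K.X i))] at e
  rw [eulerCharacteristic, alternatingSum_eq_sub (fun i hi => K0Add.of_isZero (hab i hi)), e,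
    sub_self]

lemma eulerCharacteristic_eq_of_iso {K L : CochainComplex B ℤ} (hK : K.IsBounded)
    (hL : L.IsBounded) (e : (HomotopyCategory.quotient B (ComplexShape.up ℤ)).obj K ≅
      (HomotopyCategory.quotient B (ComplexShape.up ℤ)).obj L) :
    K.eulerCharacteristic = L.eulerCharacteristic := by
  obtain ⟨f, hf⟩ := (HomotopyCategory.quotient B (ComplexShape.up ℤ)).map_surjective e.hom
  have hz : IsZero ((HomotopyCategory.quotient B (ComplexShape.up ℤ)).obj
      (CochainComplex.mappingCone f)) :=
    Triangle.isZero₃_of_isIso₁ _ (HomotopyCategory.mappingCone_triangleh_distinguished f)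
      (show IsIso ((HomotopyCategory.quotient B (ComplexShape.up ℤ)).map f) by
        rw [hf]; infer_instance)
  have h : Homotopy (𝟙 (CochainComplex.mappingCone f)) 0 :=
    HomotopyCategory.homotopyOfEq _ _ (hz.eq_of_src _ _)
  have := eulerCharacteristic_mappingCone hK hL f
  rw [eulerCharacteristic_eq_zero (hK.mappingCone hL f) h] at this
  exact (sub_eq_zero.1 this.symm).symm

/-- The third object is only homotopy equivalent to a mapping cone; its own boundedness is what lets
homotopy invariance be applied to it. -/
lemma eulerCharacteristic_of_distinguished
    (T : Triangle (HomotopyCategory B (ComplexShape.up ℤ))) (hT : T ∈ distTriang _)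
    (h₁ : IsBounded T.obj₁.as) (h₂ : IsBounded T.obj₂.as) (h₃ : IsBounded T.obj₃.as) :
    eulerCharacteristic T.obj₂.as =
      eulerCharacteristic T.obj₁.as + eulerCharacteristic T.obj₃.as := by
  obtain ⟨f, hf⟩ := (HomotopyCategory.quotient B (ComplexShape.up ℤ)).map_surjective
    (X := T.obj₁.as) (Y := T.obj₂.as) T.mor₁
  have e := Triangle.π₃.mapIso (isoTriangleOfIso₁₂ T _ hT
    (HomotopyCategory.mappingCone_triangleh_distinguished f) (Iso.refl _) (Iso.refl _)
    ((comp_id _).trans (hf.symm.trans (id_comp _).symm)))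
  rw [eulerCharacteristic_eq_of_iso h₃ (h₁.mappingCone h₂ f) e,
    eulerCharacteristic_mappingCone h₁ h₂ f, add_sub_cancel]

end CochainComplex

/-! ### Euler characteristics over semi-simple abelian categories -/

section Semisimple

variable {A : Type u} [Category.{v} A] [Abelian A]

lemma IsSemisimpleAbelian.of_shortExact (hA : IsSemisimpleAbelian A) {S : ShortComplex A}
    (hS : S.ShortExact) : K0Add.of S.X₂ = K0Add.of S.X₁ + K0Add.of S.X₃ := by
  obtain ⟨s⟩ := hA S hS
  exact K0Add.of_eq_add s.isoBinaryBiproduct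

lemma IsSemisimpleAbelian.of_eq_kernel_add_image (hA : IsSemisimpleAbelian A) {X Y : A}
    (f : X ⟶ Y) : K0Add.of X = K0Add.of (kernel f) + K0Add.of (image f) := by
  have w : kernel.ι f ≫ factorThruImage f = 0 := by
    rw [← cancel_mono (image.ι f), assoc, image.fac, kernel.condition, zero_comp]
  -- Exactness at `X` is unaffected by composing the second map with the monomorphism `image.ι f`.
  let φ : ShortComplex.mk (kernel.ι f) (factorThruImage f) w ⟶
      ShortComplex.mk (kernel.ι f) f (kernel.condition f) :=
    { τ₁ := 𝟙 _, τ₂ := 𝟙 _, τ₃ := image.ι f }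
  have : Epi φ.τ₁ := inferInstanceAs (Epi (𝟙 _))
  have : IsIso φ.τ₂ := inferInstanceAs (IsIso (𝟙 _))
  have : Mono φ.τ₃ := inferInstanceAs (Mono (image.ι f))
  exact hA.of_shortExact (S := ShortComplex.mk (kernel.ι f) (factorThruImage f) w)
    { exact := (ShortComplex.exact_iff_of_epi_of_isIso_of_mono φ).2
        (ShortComplex.exact_kernel f)
      mono_f := inferInstanceAs (Mono (kernel.ι f))
      epi_g := inferInstanceAs (Epi (factorThruImage f)) }

lemma IsSemisimpleAbelian.of_eq_image_add_cokernel (hA : IsSemisimpleAbelian A) {X Y : A}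
    (f : X ⟶ Y) : K0Add.of Y = K0Add.of (image f) + K0Add.of (cokernel f) := by
  have w : image.ι f ≫ cokernel.π f = 0 := by
    rw [← cancel_epi (factorThruImage f), ← assoc, image.fac, cokernel.condition, comp_zero]
  let φ : ShortComplex.mk f (cokernel.π f) (cokernel.condition f) ⟶
      ShortComplex.mk (image.ι f) (cokernel.π f) w :=
    { τ₁ := factorThruImage f, τ₂ := 𝟙 _, τ₃ := 𝟙 _ }
  have : Epi φ.τ₁ := inferInstanceAs (Epi (factorThruImage f))
  have : IsIso φ.τ₂ := inferInstanceAs (IsIso (𝟙 _))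
  have : Mono φ.τ₃ := inferInstanceAs (Mono (𝟙 _))
  exact hA.of_shortExact (S := ShortComplex.mk (image.ι f) (cokernel.π f) w)
    { exact := (ShortComplex.exact_iff_of_epi_of_isIso_of_mono φ).1
        (ShortComplex.exact_cokernel f)
      mono_f := inferInstanceAs (Mono (image.ι f))
      epi_g := inferInstanceAs (Epi (cokernel.π f)) }

/-- The kernel of `K^i ⟶ Z^{i+1}` is `Z^i`. -/
noncomputable def CochainComplex.kernelToCyclesIso (K : CochainComplex A ℤ) (i : ℤ) :
    kernel (K.toCycles i (i + 1)) ≅ K.cycles i :=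
  (kernelCompMono (K.toCycles i (i + 1)) (K.iCycles (i + 1))).symm ≪≫
    kernelIsoOfEq (K.toCycles_i i (i + 1)) ≪≫
    (kernelIsKernel (K.d i (i + 1))).conePointUniqueUpToIso
      (K.cyclesIsKernel i (i + 1) (by simp))

/-- The cokernel of `K^i ⟶ Z^{i+1}` is `H^{i+1}`. -/
noncomputable def CochainComplex.cokernelToCyclesIso (K : CochainComplex A ℤ) (i : ℤ) :
    cokernel (K.toCycles i (i + 1)) ≅ K.homology (i + 1) :=
  (cokernelIsCokernel (K.toCycles i (i + 1))).coconePointUniqueUpToIso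
    (K.homologyIsCokernel i (i + 1) (by simp))

/-- Splitting the kernel and the cokernel of `K^i ⟶ Z^{i+1}` off along its image gives `[K^i] +
[H^{i+1}] = [Z^i] + [Z^{i+1}]`. In the alternating sum the cycles cancel and the shifted homology
changes sign. -/
lemma CochainComplex.eulerCharacteristic_eq_alternatingSum_homology
    (hA : IsSemisimpleAbelian A) {K : CochainComplex A ℤ} (hK : K.IsBounded) :
    K.eulerCharacteristic = alternatingSum fun i => K0Add.of (K.homology i) := by
  have h (i : ℤ) : K0Add.of (K.X i) + K0Add.of (K.homology (i + 1)) =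
      K0Add.of (K.cycles i) + K0Add.of (K.cycles (i + 1)) := by
    rw [hA.of_eq_kernel_add_image (K.toCycles i (i + 1)),
      hA.of_eq_image_add_cokernel (K.toCycles i (i + 1)),
      K0Add.of_iso (K.kernelToCyclesIso i), K0Add.of_iso (K.cokernelToCyclesIso i)]
    abel
  have hX := hK.isBoundedFamily
  obtain ⟨a, b, hK⟩ := hK
  have hZ : IsBoundedFamily fun i => K0Add.of (K.cycles i) :=
    K0Add.of_isBoundedFamily fun i hi => (hK i hi).of_mono (K.iCycles i)
  have hH : IsBoundedFamily fun i => K0Add.of (K.homology i) :=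
    K0Add.of_isBoundedFamily fun i hi =>
      ((hK i hi).of_mono (K.iCycles i)).of_epi (K.homologyπ i)
  have := congrArg alternatingSum (funext h)
  rw [alternatingSum_add hX (hH.shift 1), alternatingSum_add hZ (hZ.shift 1),
    alternatingSum_shift (fun i => K0Add.of (K.homology i)),
    alternatingSum_shift (fun i => K0Add.of (K.cycles i)), add_neg_cancel] at this
  exact eq_of_sub_eq_zero ((sub_eq_add_neg _ _).trans this)

end Semisimple

/-! ### The Grothendieck group of a triangulated category -/

namespace K0Tr

variable {C : Type u} [Category.{v} C] [Preadditive C] [HasZeroObject C] [HasShift C ℤ]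
  [∀ n : ℤ, (shiftFunctor C n).Additive] [Pretriangulated C]

lemma of_distinguished {T : Triangle C} (hT : T ∈ distTriang C) :
    K0Tr.of T.obj₂ = K0Tr.of T.obj₁ + K0Tr.of T.obj₃ := by
  rw [← sub_eq_zero]
  exact (QuotientAddGroup.eq_zero_iff _).2 (AddSubgroup.subset_closure ⟨T, hT, rfl⟩)

lemma of_iso {X Y : C} (e : X ≅ Y) : K0Tr.of X = K0Tr.of Y := by
  unfold K0Tr.of isoClassGen
  rw [Quotient.sound (s := isIsomorphicSetoid C) (show Nonempty (X ≅ Y) from ⟨e⟩)]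

lemma of_isZero {X : C} (h : IsZero X) : K0Tr.of X = 0 := by
  have := of_distinguished (contractible_distinguished X)
  -- For zero `X` the triangle `X ⟶ X ⟶ 0` reads `[X] = [X] + [X]`.
  rw [show K0Tr.of (contractibleTriangle X).obj₃ = K0Tr.of X from
    of_iso ((isZero_zero C).iso h)] at this
  simpa using this

lemma of_shift_one (X : C) : K0Tr.of (X⟦(1 : ℤ)⟧) = -K0Tr.of X := by
  have := of_distinguished (rot_of_distTriang _ (contractible_distinguished X))
  rw [show K0Tr.of (contractibleTriangle X).rotate.obj₂ = 0 from
    of_isZero (isZero_zero C)] at this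
  exact eq_neg_of_add_eq_zero_right this.symm

lemma of_shift_neg_one (X : C) : K0Tr.of (X⟦(-1 : ℤ)⟧) = -K0Tr.of X := by
  have := of_iso ((shiftFunctorCompIsoId C (-1 : ℤ) 1 (by lia)).app X)
  exact neg_eq_iff_eq_neg.1 ((of_shift_one _).symm.trans this)

/-- The homomorphism out of `K_0^tr(C)` given by an invariant that is additive on distinguished
triangles. -/
def lift {M : Type*} [AddCommGroup M] (f : C → M)
    (hf : ∀ T ∈ distTriang C, f T.obj₂ = f T.obj₁ + f T.obj₃)
    (hf' : ∀ X Y : C, Nonempty (X ≅ Y) → f X = f Y) : K0Tr C →+ M :=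
  QuotientAddGroup.lift _ (FreeAbelianGroup.lift (Quotient.lift f hf')) (by
    rw [K0TrRel, AddSubgroup.closure_le]
    rintro _ ⟨T, hT, rfl⟩
    simp only [isoClassGen, SetLike.mem_coe, AddMonoidHom.mem_ker, map_sub, map_add,
      FreeAbelianGroup.lift_apply_of]
    exact sub_eq_zero.2 (hf T hT))

@[simp]
lemma lift_of {M : Type*} [AddCommGroup M] (f : C → M)
    (hf : ∀ T ∈ distTriang C, f T.obj₂ = f T.obj₁ + f T.obj₃)
    (hf' : ∀ X Y : C, Nonempty (X ≅ Y) → f X = f Y) (X : C) :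
    lift f hf hf' (K0Tr.of X) = f X :=
  FreeAbelianGroup.lift_apply_of _ _

lemma hom_ext {M : Type*} [AddCommGroup M] {f g : K0Tr C →+ M}
    (h : ∀ X : C, f (K0Tr.of X) = g (K0Tr.of X)) : f = g := by
  apply QuotientAddGroup.addMonoidHom_ext
  apply FreeAbelianGroup.lift_ext
  rintro ⟨X⟩
  exact h X

lemma eq_top_of_forall_of_mem {H : AddSubgroup (K0Tr C)} (h : ∀ X : C, K0Tr.of X ∈ H) :
    H = ⊤ := by
  rw [← QuotientAddGroup.ker_mk' H, AddMonoidHom.ker_eq_top_iff]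
  exact hom_ext fun X => (QuotientAddGroup.eq_zero_iff _).2 (h X)

end K0Tr

/-! ### The heart generates -/

namespace WeightStructure

variable {C : Type u} [Category.{v} C] [Preadditive C] [HasZeroObject C] [HasShift C ℤ]
  [∀ n : ℤ, (shiftFunctor C n).Additive] [Pretriangulated C] (w : WeightStructure C)

lemma le_of_iso {X Y : C} (e : X ≅ Y) (h : w.le X) : w.le Y :=
  w.le_retract ⟨e.inv, e.hom, e.inv_hom_id⟩ h

lemma ge_of_iso {X Y : C} (e : X ≅ Y) (h : w.ge X) : w.ge Y :=
  w.ge_retract ⟨e.inv, e.hom, e.inv_hom_id⟩ h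

lemma le_of_distinguished {T : Triangle C} (hT : T ∈ distTriang C) (h₁ : w.le T.obj₁)
    (h₃ : w.le T.obj₃) : w.le T.obj₂ :=
  w.le_of_orthogonal fun R hR f => by
    obtain ⟨g, rfl⟩ := Triangle.yoneda_exact₂ _ hT f (w.orthogonal h₁ hR _)
    rw [w.orthogonal h₃ hR g, comp_zero]

lemma ge_of_distinguished {T : Triangle C} (hT : T ∈ distTriang C) (h₁ : w.ge T.obj₁)
    (h₃ : w.ge T.obj₃) : w.ge T.obj₂ :=
  w.ge_of_orthogonal fun L hL f => by
    obtain ⟨g, rfl⟩ := Triangle.coyoneda_exact₂ _ (Triangle.shift_distinguished _ hT 1) f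
      (w.orthogonal hL h₃ _)
    have : g = 0 := w.orthogonal hL h₁ g
    rw [this, zero_comp]
    rfl

lemma leAt_of_le {n m : ℤ} (hnm : n ≤ m) {X : C} (h : w.leAt n X) : w.leAt m X := by
  obtain ⟨k, rfl⟩ := Int.le.dest hnm
  clear hnm
  induction k with
  | zero => simpa using h
  | succ k ih =>
    exact w.le_of_iso ((shiftFunctorAdd' C (-(n + k)) (-1) (-(n + (k + 1 : ℕ)))
      (by push_cast; ring)).app X).symm (w.le_shift ih)

lemma leAt_of_distinguished {T : Triangle C} (hT : T ∈ distTriang C) {n : ℤ}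
    (h₁ : w.leAt n T.obj₁) (h₃ : w.leAt n T.obj₃) : w.leAt n T.obj₂ :=
  w.le_of_distinguished (Triangle.shift_distinguished _ hT (-n)) h₁ h₃

lemma leAt_shift_one_iff {n : ℤ} {X : C} : w.leAt (n + 1) (X⟦(1 : ℤ)⟧) ↔ w.leAt n X :=
  let e := (shiftFunctorAdd' C 1 (-(n + 1)) (-n) (by ring)).app X
  ⟨fun h => w.le_of_iso e.symm h, fun h => w.le_of_iso e h⟩

lemma leAt_zero_iff {X : C} : w.leAt 0 X ↔ w.le X :=
  let e := (shiftFunctorZero' C (-0 : ℤ) neg_zero).app X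
  ⟨fun h => w.le_of_iso e h, fun h => w.le_of_iso e.symm h⟩

/-- The homomorphism `K_0^add(Hw) → K_0^tr(C)` induced by the embedding of the heart. -/
noncomputable def heartK0 : K0Add w.Heart →+ K0Tr C :=
  K0Add.lift (fun X => K0Tr.of X.obj)
    (fun X Y Z ⟨e⟩ => by
      have := preservesBinaryBiproducts_of_preservesBiproducts w.heart.ι
      exact (K0Tr.of_iso (w.heart.ι.mapIso e ≪≫ w.heart.ι.mapBiprod X Z)).trans <|
        K0Tr.of_distinguished (binaryBiproductTriangle_distinguished X.obj Z.obj))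
    (fun _ _ ⟨e⟩ => K0Tr.of_iso (w.heart.ι.mapIso e))

@[simp]
lemma heartK0_of (X : w.Heart) : w.heartK0 (K0Add.of X) = K0Tr.of X.obj :=
  K0Add.lift_of _ _ _ _

/-- Induction on the length of the weight range: in `L ⟶ M ⟶ R[1]`, the object `L` lies in the heart
and `R` has a range shorter by one, while `[M] = [L] - [R]`. -/
lemma of_mem_range_heartK0_of_ge (n : ℕ) (M : C) (hM : w.ge M) (hM' : w.leAt n M) :
    K0Tr.of M ∈ w.heartK0.range := by
  induction n generalizing M with
  | zero => exact ⟨K0Add.of ⟨M, w.leAt_zero_iff.1 hM', hM⟩, w.heartK0_of _⟩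
  | succ n ih =>
    obtain ⟨L, R, hL, hR, a, b, c, hT⟩ := w.decomposition M
    -- `L` is an extension of `M` by `R`, both of weight at least 0.
    have hL' : w.ge L := w.ge_of_distinguished (inv_rot_of_distTriang _ hT)
      (w.ge_of_iso ((shiftFunctorCompIsoId C (1 : ℤ) (-1) (by lia)).app R).symm hR) hM
    -- `R[1]` is an extension of `L[1]` by `M`, both of weight at most `n + 1`.
    have hR' : w.leAt n R := by
      rw [← leAt_shift_one_iff]
      refine w.leAt_of_distinguished (rot_of_distTriang _ hT) (by exact_mod_cast hM') ?_
      exact w.leAt_shift_one_iff.2 (w.leAt_of_le (by lia) (w.leAt_zero_iff.2 hL))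
    rw [show K0Tr.of M = K0Tr.of L + K0Tr.of (R⟦(1 : ℤ)⟧) from K0Tr.of_distinguished hT,
      K0Tr.of_shift_one]
    exact add_mem ⟨K0Add.of ⟨L, hL, hL'⟩, w.heartK0_of _⟩ (neg_mem (ih R hR hR'))

lemma of_shift_mem_iff (H : AddSubgroup (K0Tr C)) (M : C) (n : ℤ) :
    K0Tr.of (M⟦n⟧) ∈ H ↔ K0Tr.of M ∈ H := by
  induction n with
  | zero => rw [K0Tr.of_iso ((shiftFunctorZero C ℤ).app M)]; rfl
  | succ n ih =>
    rw [K0Tr.of_iso ((shiftFunctorAdd C (n : ℤ) 1).app M)]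
    exact (by rw [Functor.comp_obj, K0Tr.of_shift_one, neg_mem_iff, ih])
  | pred n ih =>
    rw [K0Tr.of_iso ((shiftFunctorAdd' C (-n : ℤ) (-1) (-n - 1) (by ring)).app M)]
    exact (by rw [Functor.comp_obj, K0Tr.of_shift_neg_one, neg_mem_iff, ih])

lemma heartK0_surjective (hw : w.IsBounded) : Function.Surjective w.heartK0 := by
  rw [← AddMonoidHom.range_eq_top]
  refine K0Tr.eq_top_of_forall_of_mem fun M => ?_
  obtain ⟨⟨i, hi⟩, ⟨j, hj⟩⟩ := hw M
  -- A shift changes the class only by a sign, so the lower weight bound may be moved to 0.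
  rw [← of_shift_mem_iff _ M (-j)]
  refine w.of_mem_range_heartK0_of_ge (i - j).toNat _ hj (w.leAt_of_le (n := i - j) (by lia) ?_)
  exact w.le_of_iso ((shiftFunctorAdd' C (-j) (-(i - j)) (-i) (by ring)).app M) hi

end WeightStructure

/-! ### Euler characteristics of weight complexes -/

section WeightComplexes

variable {C : Type u} [Category.{v} C] [Preadditive C] [HasZeroObject C] [HasShift C ℤ]
  [∀ n : ℤ, (shiftFunctor C n).Additive] [Pretriangulated C] {w : WeightStructure C}

section

variable {A : Type u'} [Category.{v'} A] [Preadditive A] [HasBinaryBiproducts A]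
  (F : w.Heart ⥤ A)

lemma StrongWeightComplex.IsFK0.unique {t : StrongWeightComplex w} {F : w.Heart ⥤ A}
    {φ φ' : K0Tr C →+ K0Add A} (h : t.IsFK0 F φ) (h' : t.IsFK0 F φ') : φ = φ' :=
  K0Tr.hom_ext fun M => (h M).trans (h' M).symm

variable [F.Additive]

/-- Reduces every statement about `F` to the universal invariant with values in `K0Add w.Heart`. -/
lemma eulerSum_eq_map (K : Kb w.Heart) :
    eulerSum F K = K0Add.map F (CochainComplex.eulerCharacteristic K.obj.as) := by
  have hK : CochainComplex.IsBounded K.obj.as := K.property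
  rw [CochainComplex.eulerCharacteristic, map_alternatingSum _ hK.isBoundedFamily]
  simp only [K0Add.map_of]
  rfl

lemma eulerSum_eq_of_iso {K L : Kb w.Heart} (e : K ≅ L) : eulerSum F K = eulerSum F L := by
  rw [eulerSum_eq_map, eulerSum_eq_map,
    CochainComplex.eulerCharacteristic_eq_of_iso K.property L.property
      ((boundedComplexes w.Heart).ι.mapIso e)]

lemma eulerSum_of_distinguished {T : Triangle (Kb w.Heart)} (hT : T ∈ distTriang _) :
    eulerSum F T.obj₂ = eulerSum F T.obj₁ + eulerSum F T.obj₃ := by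
  have := CochainComplex.eulerCharacteristic_of_distinguished _
    ((boundedComplexes w.Heart).ι.map_distinguished T hT) T.obj₁.property T.obj₂.property
    T.obj₃.property
  rw [eulerSum_eq_map, eulerSum_eq_map, eulerSum_eq_map, ← map_add]
  exact congrArg _ this

lemma eulerSum_KbSingle (X : w.Heart) :
    eulerSum F ((KbSingle w.Heart).obj X) = K0Add.of (F.obj X) := by
  rw [eulerSum_eq_map, ← K0Add.map_of]
  congr 1
  refine (finsum_eq_single _ (0 : ℤ) fun i hi => ?_).trans ?_
  · have h := K0Add.of_isZero
      (HomologicalComplex.isZero_single_obj_X (ComplexShape.up ℤ) 0 X i hi)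
    exact (congrArg (i.negOnePow • ·) h).trans (smul_zero _)
  · rw [Int.negOnePow_zero, one_smul]
    exact K0Add.of_iso (HomologicalComplex.singleObjXSelf (ComplexShape.up ℤ) 0 X)

namespace StrongWeightComplex

variable (t : StrongWeightComplex w)

lemma eulerSum_functor_of_distinguished (T : Triangle C) (hT : T ∈ distTriang C) :
    eulerSum F (t.functor.obj T.obj₂) =
      eulerSum F (t.functor.obj T.obj₁) + eulerSum F (t.functor.obj T.obj₃) := by
  have h := eulerSum_of_distinguished F (t.functor.map_distinguished T hT)
  simp only [Functor.mapTriangle_obj, Triangle.mk_obj₁, Triangle.mk_obj₂,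
    Triangle.mk_obj₃] at h
  exact h

/-- The homomorphism `F_{K_0}`. -/
noncomputable def mapK0 : K0Tr C →+ K0Add A :=
  K0Tr.lift (fun M => eulerSum F (t.functor.obj M))
    (t.eulerSum_functor_of_distinguished F)
    (fun _ _ ⟨e⟩ => eulerSum_eq_of_iso F (t.functor.mapIso e))

lemma isFK0_mapK0 : t.IsFK0 F (t.mapK0 F) := fun _ => K0Tr.lift_of _ _ _ _

variable {t F}

lemma IsFK0.of_heart {φ : K0Tr C →+ K0Add A} (h : t.IsFK0 F φ) (X : w.Heart) :
    φ (K0Tr.of X.obj) = K0Add.of (F.obj X) := by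
  rw [h, ← eulerSum_KbSingle]
  exact eulerSum_eq_of_iso F (t.heartIso.app X)

end StrongWeightComplex

end

namespace StrongWeightComplex

variable (t : StrongWeightComplex w)

lemma mapK0_id_bijective (hw : w.IsBounded) : Function.Bijective (t.mapK0 (𝟭 w.Heart)) := by
  have h : (t.mapK0 (𝟭 w.Heart)).comp w.heartK0 = AddMonoidHom.id _ := K0Add.hom_ext fun X => by
    rw [AddMonoidHom.comp_apply, w.heartK0_of, (t.isFK0_mapK0 (𝟭 w.Heart)).of_heart]
    rfl
  have hl : Function.LeftInverse (t.mapK0 (𝟭 w.Heart)) w.heartK0 := DFunLike.congr_fun h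
  -- A surjective map with a left inverse is invertible, and the left inverse is its inverse.
  exact ⟨(hl.rightInverse_of_surjective (w.heartK0_surjective hw)).injective, hl.surjective⟩

variable {A : Type u'} [Category.{v'} A] [Abelian A] (F : w.Heart ⥤ A) [F.Additive]

/-- The complexes `(F(M^i))`, as an exact functor to the homotopy category. -/
noncomputable abbrev mapComplex : C ⥤ HomotopyCategory A (ComplexShape.up ℤ) :=
  t.functor ⋙ (boundedComplexes w.Heart).ι ⋙ F.mapHomotopyCategory (ComplexShape.up ℤ)

instance : (t.pureFunctor F).IsHomological :=
  inferInstanceAs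
    (t.mapComplex F ⋙ HomotopyCategory.homologyFunctor A (ComplexShape.up ℤ) 0).IsHomological

/-- `H^F` restricts to `F` on the heart. -/
noncomputable def pureFunctorHeartIso (X : w.Heart) : (t.pureFunctor F).obj X.obj ≅ F.obj X :=
  ((boundedComplexes w.Heart).ι ⋙ F.mapHomotopyCategory (ComplexShape.up ℤ) ⋙
    HomotopyCategory.homologyFunctor A (ComplexShape.up ℤ) 0).mapIso (t.heartIso.app X) ≪≫
  (HomotopyCategory.homologyFunctorFactors A (ComplexShape.up ℤ) 0).app
    ((F.mapHomologicalComplex (ComplexShape.up ℤ)).obj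
      ((HomologicalComplex.single w.Heart (ComplexShape.up ℤ) 0).obj X)) ≪≫
  (HomologicalComplex.homologyFunctor A (ComplexShape.up ℤ) 0).mapIso
    ((HomologicalComplex.singleMapHomologicalComplex F (ComplexShape.up ℤ) 0).app X) ≪≫
  HomologicalComplex.singleObjHomologySelfIso (ComplexShape.up ℤ) 0 (F.obj X)

/-- `H^F_i(M)` is the homology of `(F(M^i))` in degree `-i`. -/
noncomputable def pureFunctorAtIso (i : ℤ) (M : C) :
    (t.pureFunctorAt F i).obj M ≅
      ((F.mapHomologicalComplex (ComplexShape.up ℤ)).obj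
        (t.functor.obj M).obj.as).homology (-i) :=
  (HomotopyCategory.homologyFunctor A (ComplexShape.up ℤ) 0).mapIso
    (((t.mapComplex F).commShiftIso (-i)).app M) ≪≫
  ((HomotopyCategory.homologyFunctor A (ComplexShape.up ℤ) 0).shiftIso (-i) 0 (-i)
    (add_zero _)).app ((t.mapComplex F).obj M) ≪≫
  (HomotopyCategory.homologyFunctorFactors A (ComplexShape.up ℤ) (-i)).app
    ((F.mapHomologicalComplex (ComplexShape.up ℤ)).obj (t.functor.obj M).obj.as)

/-- In the exact sequence `H^F(Z[-1]) ⟶ H^F(X) ⟶ H^F(Y) ⟶ H^F(Z)` the outer terms are `H^F_1(Z)`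
and, up to isomorphism, `H^F_0(Z)`. -/
lemma isIso_pureFunctor_map {X Y Z : C} {h : X ⟶ Y} (hZ : IsConeOf h Z)
    (h₀ : IsZero ((t.pureFunctorAt F 0).obj Z)) (h₁ : IsZero ((t.pureFunctorAt F 1).obj Z)) :
    IsIso ((t.pureFunctor F).map h) := by
  obtain ⟨g, d, hT⟩ := hZ
  have h₀' : IsZero ((t.pureFunctor F).obj Z) :=
    h₀.of_iso ((t.pureFunctor F).mapIso ((shiftFunctorZero' C (-0 : ℤ) neg_zero).app Z)).symm
  have : Epi ((t.pureFunctor F).map h) :=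
    ((t.pureFunctor F).map_distinguished_exact _ hT).epi_f (h₀'.eq_of_tgt _ _)
  have : Mono ((t.pureFunctor F).map h) :=
    ((t.pureFunctor F).map_distinguished_exact _ (inv_rot_of_distTriang _ hT)).mono_g
      (h₁.eq_of_src _ _)
  exact isIso_of_mono_of_epi _

lemma eulerSum_eq_alternatingSum (hA : IsSemisimpleAbelian A) (M : C) :
    eulerSum F (t.functor.obj M) =
      ∑ᶠ i : ℤ, i.negOnePow • K0Add.of ((t.pureFunctorAt F i).obj M) := by
  have hK : CochainComplex.IsBounded ((F.mapHomologicalComplex (ComplexShape.up ℤ)).obj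
      (t.functor.obj M).obj.as) := by
    obtain ⟨a, b, h⟩ := (t.functor.obj M).property
    exact ⟨a, b, fun i hi => F.map_isZero (h i hi)⟩
  refine (CochainComplex.eulerCharacteristic_eq_alternatingSum_homology hA hK).trans ?_
  -- `H^F_i` is cohomology in degree `-i`; the sign `(-1)^i` is insensitive to this.
  rw [← alternatingSum_neg]
  exact finsum_congr fun i => by rw [K0Add.of_iso (t.pureFunctorAtIso F i M)]

end StrongWeightComplex

end WeightComplexes

theorem theorem1p3p4 {C : Type u} [Category.{v} C] [Preadditive C] [HasZeroObject C]
    [HasShift C ℤ] [∀ n : ℤ, (shiftFunctor C n).Additive] [Pretriangulated C] [IsTriangulated C]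
    (w : WeightStructure C) (hw : w.IsBounded) (t : StrongWeightComplex w) :
    -- 1. `F_{K_0}` is a well-defined homomorphism
    (∀ (A : Type u') [Category.{v'} A] [Preadditive A] [HasZeroObject A] [HasBinaryBiproducts A]
      (F : w.Heart ⥤ A) [F.Additive],
      (∃! φ : K0Tr C →+ K0Add A, t.IsFK0 F φ) ∧
      ∀ (M : C) (K : Kb w.Heart), Nonempty (t.functor.obj M ≅ K) →
        eulerSum F (t.functor.obj M) = eulerSum F K) ∧
    -- 2. morphisms to and from objects of the heart
    (∀ (A : Type u') [Category.{v'} A] [Abelian A] (F : w.Heart ⥤ A) [F.Additive]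
      (φ : K0Tr C →+ K0Add A), t.IsFK0 F φ →
      ∀ (N : C) (N' : w.Heart) (Z : C),
        ((∃ h : N'.obj ⟶ N, IsConeOf h Z) ∨ (∃ h : N ⟶ N'.obj, IsConeOf h Z)) →
        φ (K0Tr.of Z) = 0 →
        φ (K0Tr.of N) = K0Add.of (F.obj N') ∧
        (IsZero ((t.pureFunctorAt F 0).obj Z) → IsZero ((t.pureFunctorAt F 1).obj Z) →
          φ (K0Tr.of N) = K0Add.of ((t.pureFunctor F).obj N))) ∧
    -- 3. the semi-simple case
    (∀ (A : Type u') [Category.{v'} A] [Abelian A], IsSemisimpleAbelian A →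
      ∀ (F : w.Heart ⥤ A) [F.Additive] (φ : K0Tr C →+ K0Add A), t.IsFK0 F φ →
      ∀ N : C,
        φ (K0Tr.of N) = ∑ᶠ i : ℤ, i.negOnePow • K0Add.of ((t.pureFunctorAt F i).obj N)) ∧
    -- 4. the case of the identity functor of the heart
    (∃ φ : K0Tr C →+ K0Add w.Heart, t.IsFK0 (𝟭 w.Heart) φ ∧ Function.Bijective φ) := by
  refine ⟨?_, ?_, ?_, ⟨_, t.isFK0_mapK0 (𝟭 w.Heart), t.mapK0_id_bijective hw⟩⟩
  · intro A _ _ _ _ F _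
    exact ⟨⟨t.mapK0 F, t.isFK0_mapK0 F, fun φ hφ => hφ.unique (t.isFK0_mapK0 F)⟩,
      fun M K ⟨e⟩ => eulerSum_eq_of_iso F e⟩
  · intro A _ _ F _ φ hφ N N' Z hZ hφZ
    have hN : φ (K0Tr.of N) = K0Add.of (F.obj N') := by
      rw [← hφ.of_heart]
      -- The triangle gives `[N] = [N'] + [Z]` or `[N'] = [N] + [Z]`, according to the direction of
      -- `h`.
      obtain ⟨h, g, d, hT⟩ | ⟨h, g, d, hT⟩ := hZ
      · have := congrArg φ (K0Tr.of_distinguished hT)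
        rw [map_add] at this
        exact this.trans ((congrArg _ hφZ).trans (add_zero _))
      · have := congrArg φ (K0Tr.of_distinguished hT)
        rw [map_add] at this
        exact (this.trans ((congrArg _ hφZ).trans (add_zero _))).symm
    refine ⟨hN, fun h₀ h₁ => ?_⟩
    -- As `H^F(N') ≅ F(N')`, it remains to see that `H^F(h)` is an isomorphism.
    rw [hN, ← K0Add.of_iso (t.pureFunctorHeartIso F N')]
    obtain ⟨h, hh⟩ | ⟨h, hh⟩ := hZ
    · have := t.isIso_pureFunctor_map F hh h₀ h₁
      exact K0Add.of_iso (asIso ((t.pureFunctor F).map h))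
    · have := t.isIso_pureFunctor_map F hh h₀ h₁
      exact K0Add.of_iso (asIso ((t.pureFunctor F).map h)).symm
  · intro A _ _ hA F _ φ hφ N
    rw [hφ N, t.eulerSum_eq_alternatingSum F hA]
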